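/- Let $\mathbb K$ be $\mathbb R$ or $\mathbb C$; all spaces are over $\mathbb K$. A Banach space $X$ is said to be finitely representable in a Banach space $Y$ if for every $\varepsilon>0$ and every finite-dimensional linear subspace $F\subset X$ there exist a (necessarily finite-dimensional) linear subspace $G\subset Y$ and a linear isomorphism $T:F\to G$ with $\|T\|\cdot\|T^{-1}\|<1+\varepsilon$. Let $X$ and $Y$ be Banach spaces. If $X$ is finitely representable in $Y$, then there is a separable closed linear subspace $Y_0$ of $Y$ such that $X$ is finitely representable in $Y_0$. Consequently, every Banach space $Z$ is finitely representable in some separable closed linear subspace $Z_0$ of $Z$. -/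

import Mathlib

/-- `X` is finitely representable in `Y` (over the scalar field `𝕜`): for every `ε > 0` and every
finite-dimensional linear subspace `F` of `X` there are a linear subspace `G` of `Y` and a linear
isomorphism `T : F → G` (bounded in both directions) such that `‖T‖ * ‖T⁻¹‖ < 1 + ε`. -/
def FinitelyRepresentable (𝕜 : Type*) [RCLike 𝕜]
    (X : Type*) [NormedAddCommGroup X] [NormedSpace 𝕜 X]
    (Y : Type*) [NormedAddCommGroup Y] [NormedSpace 𝕜 Y] : Prop :=
  ∀ ε : ℝ, 0 < ε → ∀ F : Submodule 𝕜 X, FiniteDimensional 𝕜 F →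
    ∃ (G : Submodule 𝕜 Y) (T : F ≃L[𝕜] G),
      ‖(T : F →L[𝕜] G)‖ * ‖(T.symm : G →L[𝕜] F)‖ < 1 + ε

/-! Finite representability is transitive, so it suffices to treat `Z` inside itself. The distortion
of an operator `L` on `𝕜^n` depends only on the function `v ↦ ‖L v‖`, and these functions lie in
`C(ball, ℝ)`, which is separable even if `Z` is not. Countably many operators for each `n` thus
imitate all embeddings, and the closed span of their ranges is `Z₀`. -/

open TopologicalSpace in
/-- Continuous linear maps from a finite-dimensional space `E` into `Y`, compared only through the
functions `v ↦ ‖L v‖` on the unit ball, form a separable family. -/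
theorem exists_countable_norm_approx (𝕜 : Type*) [RCLike 𝕜]
    (E : Type*) [NormedAddCommGroup E] [NormedSpace 𝕜 E] [ProperSpace E]
    (Y : Type*) [NormedAddCommGroup Y] [NormedSpace 𝕜 Y] :
    ∃ D : Set (E →L[𝕜] Y), D.Countable ∧ ∀ L : E →L[𝕜] Y, ∀ δ : ℝ, 0 < δ →
      ∃ L' ∈ D, ∀ v : E, |‖L' v‖ - ‖L v‖| ≤ δ * ‖v‖ := by
  let N : (E →L[𝕜] Y) → C(Metric.closedBall (0 : E) 1, ℝ) :=
    fun L => ⟨fun v => ‖L v‖, by fun_prop⟩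
  have : CompactSpace (Metric.closedBall (0 : E) 1) :=
    isCompact_iff_compactSpace.mp (isCompact_closedBall _ _)
  -- Subsets of a separable metric space are separable, so the dense functions can be taken of the
  -- form `N L`.
  obtain ⟨t, hts, htc, htd⟩ :=
    (IsSeparable.of_separableSpace (Set.range N)).exists_countable_dense_subset
  choose! g hg using fun f (hf : f ∈ t) => hts hf
  refine ⟨g '' t, htc.image g, fun L δ hδ => ?_⟩
  obtain ⟨f, hf, hdist⟩ := Metric.mem_closure_iff.mp (htd ⟨L, rfl⟩) δ hδ
  refine ⟨g f, Set.mem_image_of_mem g hf, fun v => ?_⟩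
  have hball : ∀ u : E, ‖u‖ ≤ 1 → |‖g f u‖ - ‖L u‖| ≤ δ := fun u hu => by
    have hdist' : dist (N (g f)) (N L) ≤ δ := by rw [hg f hf, dist_comm]; exact hdist.le
    exact (ContinuousMap.dist_apply_le_dist (f := N (g f)) (g := N L)
      ⟨u, by simpa using hu⟩).trans hdist'
  rcases eq_or_ne v 0 with rfl | hv
  · simp
  have hpos : 0 < ‖v‖ := norm_pos_iff.mpr hv
  have h := hball (((‖v‖ : 𝕜)⁻¹) • v) (norm_smul_inv_norm hv).le
  simp only [map_smul, norm_smul, norm_inv, RCLike.norm_ofReal, abs_norm] at h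
  rwa [← mul_sub, abs_mul, abs_of_pos (inv_pos.mpr hpos), inv_mul_le_iff₀ hpos, mul_comm] at h

/-- A linear map whose norm function is close to that of an embedding is itself an embedding, with
small distortion. -/
theorem exists_continuousLinearEquiv_of_norm_bounds {𝕜 : Type*} [RCLike 𝕜]
    {F : Type*} [NormedAddCommGroup F] [NormedSpace 𝕜 F]
    {Y : Type*} [NormedAddCommGroup Y] [NormedSpace 𝕜 Y]
    (L : F →ₗ[𝕜] Y) {a b : ℝ} (ha : 0 < a) (hb : 0 ≤ b)
    (hlow : ∀ v, a * ‖v‖ ≤ ‖L v‖) (hup : ∀ v, ‖L v‖ ≤ b * ‖v‖) :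
    ∃ (G : Submodule 𝕜 Y) (T : F ≃L[𝕜] G),
      ‖(T : F →L[𝕜] G)‖ * ‖(T.symm : G →L[𝕜] F)‖ ≤ b * a⁻¹ := by
  have hinj : Function.Injective L := by
    rw [← LinearMap.ker_eq_bot, LinearMap.ker_eq_bot']
    intro v hv
    have := hlow v
    rw [hv, norm_zero] at this
    exact norm_le_zero_iff.mp (nonpos_of_mul_nonpos_right this ha)
  let e := LinearEquiv.ofInjective L hinj
  have he : ∀ v, ‖e v‖ = ‖L v‖ := fun v => rfl
  have h1 : ∀ v, ‖e v‖ ≤ b * ‖v‖ := fun v => (he v).trans_le (hup v)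
  have h2 : ∀ w, ‖e.symm w‖ ≤ a⁻¹ * ‖w‖ := fun w => by
    have := hlow (e.symm w)
    rw [← he, e.apply_symm_apply] at this
    rwa [inv_mul_eq_div, le_div_iff₀' ha]
  let T : F ≃L[𝕜] LinearMap.range L :=
    { e with
      continuous_toFun := AddMonoidHomClass.continuous_of_bound e b h1
      continuous_invFun := AddMonoidHomClass.continuous_of_bound e.symm a⁻¹ h2 }
  exact ⟨_, T, mul_le_mul (ContinuousLinearMap.opNorm_le_bound _ hb h1)
    (ContinuousLinearMap.opNorm_le_bound _ (inv_nonneg.mpr ha.le) h2) (norm_nonneg _) hb⟩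

theorem FinitelyRepresentable.trans {𝕜 : Type*} [RCLike 𝕜]
    {X : Type*} [NormedAddCommGroup X] [NormedSpace 𝕜 X]
    {Y : Type*} [NormedAddCommGroup Y] [NormedSpace 𝕜 Y]
    {Z : Type*} [NormedAddCommGroup Z] [NormedSpace 𝕜 Z]
    (hXY : FinitelyRepresentable 𝕜 X Y) (hYZ : FinitelyRepresentable 𝕜 Y Z) :
    FinitelyRepresentable 𝕜 X Z := by
  intro ε hε F hF
  obtain ⟨η, hη, hηε⟩ : ∃ η : ℝ, 0 < η ∧ (1 + η) * (1 + η) ≤ 1 + ε := by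
    -- As `η ≤ 1`, `(1 + η)² ≤ 1 + 3η ≤ 1 + ε`.
    refine ⟨min 1 (ε / 3), by positivity, ?_⟩
    have h1 := min_le_left 1 (ε / 3)
    have h2 := min_le_right 1 (ε / 3)
    have h3 : 0 < min 1 (ε / 3) := by positivity
    nlinarith
  obtain ⟨G, T, hT⟩ := hXY η hη F hF
  obtain ⟨H, S, hS⟩ := hYZ η hη G (T.toLinearEquiv.finiteDimensional)
  refine ⟨H, T.trans S, lt_of_le_of_lt ?_ ((mul_lt_mul'' hT hS (by positivity)
    (by positivity)).trans_le hηε)⟩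
  calc ‖((T.trans S : F ≃L[𝕜] H) : F →L[𝕜] H)‖ * ‖((T.trans S).symm : H →L[𝕜] F)‖
      ≤ (‖(S : G →L[𝕜] H)‖ * ‖(T : F →L[𝕜] G)‖) *
        (‖(T.symm : G →L[𝕜] F)‖ * ‖(S.symm : H →L[𝕜] G)‖) :=
        mul_le_mul (ContinuousLinearMap.opNorm_comp_le (S : G →L[𝕜] H) (T : F →L[𝕜] G))
          (ContinuousLinearMap.opNorm_comp_le (T.symm : G →L[𝕜] F) (S.symm : H →L[𝕜] G))
          (norm_nonneg _) (by positivity)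
    _ = _ := by ring

open TopologicalSpace in
theorem exists_separable_closed_finitelyRepresentable (𝕜 : Type*) [RCLike 𝕜]
    (Z : Type*) [NormedAddCommGroup Z] [NormedSpace 𝕜 Z] :
    ∃ Z₀ : Submodule 𝕜 Z, IsClosed (Z₀ : Set Z) ∧ SeparableSpace Z₀ ∧
      FinitelyRepresentable 𝕜 Z Z₀ := by
  choose D hDc hD using fun n : ℕ => exists_countable_norm_approx 𝕜 (Fin n → 𝕜) Z
  let s : Set Z := ⋃ n, ⋃ L ∈ D n, Set.range L
  have hs : IsSeparable s := .iUnion fun n => by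
    have := (hDc n).to_subtype
    rw [Set.biUnion_eq_iUnion]
    exact .iUnion fun L => isSeparable_range L.1.continuous
  let Z₀ := (Submodule.span 𝕜 s).topologicalClosure
  have hZ₀ : IsSeparable (Z₀ : Set Z) := (hs.span (R := 𝕜)).closure
  refine ⟨Z₀, Submodule.isClosed_topologicalClosure _, hZ₀.separableSpace, ?_⟩
  intro ε hε F hF
  let e : (Fin (Module.finrank 𝕜 F) → 𝕜) ≃L[𝕜] F :=
    ContinuousLinearEquiv.ofFinrankEq (by simp)
  -- The `+ 1` keeps `c` positive when `F` is trivial.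
  let c : ℝ := ‖(e.symm : F →L[𝕜] (Fin (Module.finrank 𝕜 F) → 𝕜))‖ + 1
  have hc : 0 < c := by positivity
  -- With `δ = ε / (3 + ε)`, `(1 + δ) / (1 - δ) = 1 + 2ε/3 < 1 + ε`.
  have hδ : 0 < ε / (3 + ε) := by positivity
  obtain ⟨L, hL, hLe⟩ := hD _
    (F.subtypeL.comp (e : (Fin (Module.finrank 𝕜 F) → 𝕜) →L[𝕜] F)) (ε / (3 + ε) / c) (by positivity)
  have hmem : ∀ v, L v ∈ Z₀ := fun v => Submodule.le_topologicalClosure _ <|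
    Submodule.subset_span <| Set.mem_iUnion.mpr ⟨_, Set.mem_biUnion hL ⟨v, rfl⟩⟩
  have hbd : ∀ w : F, |‖L (e.symm w)‖ - ‖w‖| ≤ ε / (3 + ε) * ‖w‖ := fun w => by
    have h1 := hLe (e.symm w)
    have h2 : ‖e.symm w‖ ≤ c * ‖w‖ :=
      ((e.symm : F →L[𝕜] (Fin (Module.finrank 𝕜 F) → 𝕜)).le_opNorm w).trans (by gcongr; simp [c])
    have h3 : ‖((e (e.symm w) : F) : Z)‖ = ‖w‖ := by simp
    change |_ - ‖((e (e.symm w) : F) : Z)‖| ≤ _ at h1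
    rw [h3] at h1
    calc _ ≤ _ := h1
      _ ≤ ε / (3 + ε) / c * (c * ‖w‖) := by gcongr
      _ = _ := by field_simp
  let T : F →ₗ[𝕜] Z₀ :=
    ((L : _ →ₗ[𝕜] Z).codRestrict Z₀ hmem).comp e.symm.toLinearEquiv.toLinearMap
  have hT : ∀ w, ‖T w‖ = ‖L (e.symm w)‖ := fun w => rfl
  have hlt : ε / (3 + ε) < 1 := by rw [div_lt_one (by positivity)]; linarith
  obtain ⟨G, S, hS⟩ := exists_continuousLinearEquiv_of_norm_bounds T
    (a := 1 - ε / (3 + ε)) (b := 1 + ε / (3 + ε)) (by linarith) (by positivity)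
    (fun w => by rw [hT]; linarith [(abs_le.mp (hbd w)).1])
    (fun w => by rw [hT]; linarith [(abs_le.mp (hbd w)).2])
  refine ⟨G, S, hS.trans_lt ?_⟩
  have h1 : 1 - ε / (3 + ε) = 3 / (3 + ε) := by field_simp; ring
  have h2 : 1 + ε / (3 + ε) = (3 + 2 * ε) / (3 + ε) := by field_simp; ring
  rw [h1, h2, inv_div, div_mul_div_cancel₀ (by positivity), div_lt_iff₀ (by norm_num)]
  linarith

theorem corollary4p11 (𝕜 : Type*) [RCLike 𝕜] :
    (∀ (X : Type*) [NormedAddCommGroup X] [NormedSpace 𝕜 X] [CompleteSpace X]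
        (Y : Type*) [NormedAddCommGroup Y] [NormedSpace 𝕜 Y] [CompleteSpace Y],
        FinitelyRepresentable 𝕜 X Y →
          ∃ Y₀ : Submodule 𝕜 Y, IsClosed (Y₀ : Set Y) ∧
            TopologicalSpace.SeparableSpace Y₀ ∧ FinitelyRepresentable 𝕜 X Y₀) ∧
    (∀ (Z : Type*) [NormedAddCommGroup Z] [NormedSpace 𝕜 Z] [CompleteSpace Z],
        ∃ Z₀ : Submodule 𝕜 Z, IsClosed (Z₀ : Set Z) ∧
          TopologicalSpace.SeparableSpace Z₀ ∧ FinitelyRepresentable 𝕜 Z Z₀) := by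
  refine ⟨fun X _ _ _ Y _ _ _ h => ?_, fun Z _ _ _ =>
    exists_separable_closed_finitelyRepresentable 𝕜 Z⟩
  obtain ⟨Y₀, hc, hs, hr⟩ := exists_separable_closed_finitelyRepresentable 𝕜 Y
  exact ⟨Y₀, hc, hs, h.trans hr⟩
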